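/- Let $E_4=1+240\sum_{n\ge1}\sigma_3(n)q^n$ and $E_6=1-504\sum_{n\ge1}\sigma_5(n)q^n$, $q=e^{2\pi i z}$, be the normalized Eisenstein series of weights $4$ and $6$ for $SL_2(\mathbb Z)$, and let $\Delta=(E_4^3-E_6^2)/1728$. For functions $f_1,\dots,f_k$ on the upper half-plane given by $q$-expansions, define the $q$-Wronskian $$W_q(f_1,\dots,f_k)=\det\left(\left(q\tfrac{d}{dq}\right)^{i-1}f_j\right)_{1\le i,j\le k},\qquad q\tfrac{d}{dq}=\tfrac{1}{2\pi i}\tfrac{d}{dz}.$$ Let $t\ge1$ be an integer and let $M_{12t}$ be the complex vector space of modular forms of weight $12t$ for $SL_2(\mathbb Z)$. Then the forms $(E_4^3)^u(E_6^2)^{t-u}$, $0\le u\le t$, are a basis of $M_{12t}$, and there is a constant $\lambda\in\mathbb C$, $\lambda\ne0$ (which may depend on $t$), such that $$W_q\left((E_4^3)^u(E_6^2)^{t-u},\ 0\le u\le t\right)=\lambda\,\Delta^{t(t+1)/2}\,E_4^{t(t+1)}\,E_6^{t(t+1)/2},$$ both as an identity of $q$-expansions and of functions on the upper half-plane. -/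

import Mathlib

open UpperHalfPlane
open scoped MatrixGroups

noncomputable section

/-- The operator `q d/dq` on formal power series in `q`. -/
def qEulerDerivation (f : PowerSeries ℂ) : PowerSeries ℂ :=
  PowerSeries.X * PowerSeries.derivative ℂ f

theorem coeff_qEulerDerivation (f : PowerSeries ℂ) (n : ℕ) :
    (qEulerDerivation f).coeff n = n * f.coeff n := by
  cases n with
  | zero => simp [qEulerDerivation]
  | succ n =>
    rw [qEulerDerivation, PowerSeries.coeff_succ_X_mul, PowerSeries.coeff_derivative]
    push_cast
    ring

/-- The `q`-Wronskian of a family of functions on the upper half-plane of period `1`, computed on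
their `q`-expansions, `q = exp (2 π i z)`: the determinant of the matrix with rows
`(q d/dq)^i f_0, …, (q d/dq)^i f_{k-1}` for `0 ≤ i ≤ k - 1`. -/
def qWronskianSeries {k : ℕ} (f : Fin k → ℍ → ℂ) : PowerSeries ℂ :=
  Matrix.det (Matrix.of fun i j : Fin k => qEulerDerivation^[(i : ℕ)] (qExpansion 1 (f j)))

/-- The same `q`-Wronskian as a function on the upper half-plane, where `q d/dq` is the operator
`(2 π i)⁻¹ d/dz`. -/
def qWronskian {k : ℕ} (f : Fin k → ℍ → ℂ) (z : ℍ) : ℂ :=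
  Matrix.det (Matrix.of fun i j : Fin k =>
    (Derivative.normalizedDerivOfComplex^[(i : ℕ)] (f j)) z)

/-- The form `(E₄ ^ 3) ^ u * (E₆ ^ 2) ^ (t - u)` of weight `12 t` for `SL(2, ℤ)`, `0 ≤ u ≤ t`. -/
def eisensteinMonomial (t : ℕ) (u : Fin (t + 1)) : ModularForm 𝒮ℒ (12 * (t : ℤ)) :=
  ModularForm.mcast
    (by
      have hu : (u : ℕ) ≤ t := Nat.lt_succ_iff.mp u.isLt
      push_cast [Nat.cast_sub hu]
      ring)
    (((ModularForm.E₄.pow 3).pow (u : ℕ)).mul ((ModularForm.E₆.pow 2).pow (t - (u : ℕ))))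

theorem coe_eisensteinMonomial (t : ℕ) (u : Fin (t + 1)) :
    (eisensteinMonomial t u : ℍ → ℂ) =
      ((ModularForm.E₄ : ℍ → ℂ) ^ 3) ^ (u : ℕ) *
        ((ModularForm.E₆ : ℍ → ℂ) ^ 2) ^ (t - (u : ℕ)) := by
  rw [eisensteinMonomial]
  simp only [ModularForm.coe_mcast, ModularForm.coe_mul, ModularForm.coe_pow]

end

/-! With `D = q d/dq`, `f = E₄ ^ 3`, `g = E₆ ^ 2`, the monomials are `g ^ t * x ^ u` with `x = f /
g`. In any commutative ring with a derivation, the Wronskian matrix of `h * x ^ u` is a lower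
triangular matrix times an upper triangular one, so its determinant is a product of factorials times
`h ^ (t + 1) * (D x) ^ (t (t + 1) / 2)` (`Derivation.det_iterate_mul_pow`). Clearing denominators
leaves a power of `D f * g - f * D g`, which is `E₄ ^ 2 * E₆` times the bracket `3 D(E₄) E₆ - 2 E₄
D(E₆)`. The bracket is a cusp form of weight `12`, hence `1728 Δ`
(`eisensteinBracket_eq_smul_discriminant`).

The computation takes place on power series, where `E₆` is invertible, and passes to functions by
injectivity of the `q`-expansion. Non-vanishing of the Wronskian gives independence, and the
dimension `t + 1` gives spanning. -/

section

open scoped Manifold ModularForm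

/-! ### Wronskians in a commutative ring with a derivation. -/

/-- The iterated derivatives of `h * x ^ u` are combinations, with triangular coefficients that do
not depend on `u`, of the divided falling powers of `x`. -/
theorem Derivation.exists_iterate_mul_pow {k R : Type*} [CommRing k] [CommRing R] [Algebra k R]
    (d : Derivation k R R)
    (h x : R) :
    ∃ B : ℕ → ℕ → R, (∀ i k, i < k → B i k = 0) ∧ (∀ i, B i i = h * d x ^ i) ∧
      ∀ i u, d^[i] (h * x ^ u) =
        ∑ k ∈ Finset.range (i + 1), B i k * (u.descFactorial k * x ^ (u - k)) := by
  -- Product rule: differentiating the coefficient keeps `k`; differentiating `x ^ (u - k)` raises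
  -- `k` by one and contributes `d x`.
  let B : ℕ → ℕ → R := fun i => Nat.rec (fun k => if k = 0 then h else 0)
    (fun _ b k => d (b k) + if k = 0 then 0 else b (k - 1) * d x) i
  have hB0 (k) : B 0 k = if k = 0 then h else 0 := rfl
  have hBs (i k) : B (i + 1) k = d (B i k) + if k = 0 then 0 else B i (k - 1) * d x := rfl
  have hlt : ∀ i k, i < k → B i k = 0 := by
    intro i
    induction i with
    | zero => intro k hk; rw [hB0, if_neg hk.ne']
    | succ i ih =>
      intro k hk
      rw [hBs, ih k (by lia), ih (k - 1) (by lia)]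
      simp
  refine ⟨B, hlt, fun i => ?_, fun i u => ?_⟩
  · induction i with
    | zero => simp [hB0]
    | succ i ih =>
      rw [hBs, hlt i (i + 1) (by lia), if_neg (by lia), Nat.add_sub_cancel, ih]
      simp
      ring
  · induction i with
    | zero => simp [hB0]
    | succ i ih =>
      have hterm (k : ℕ) : d (B i k * (u.descFactorial k * x ^ (u - k))) =
          d (B i k) * (u.descFactorial k * x ^ (u - k)) +
            B i k * d x * (u.descFactorial (k + 1) * x ^ (u - (k + 1))) := by
        rw [d.leibniz, d.leibniz, d.leibniz_pow, d.map_natCast, Nat.descFactorial_succ,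
          Nat.sub_sub]
        simp only [smul_eq_mul, nsmul_eq_mul]
        push_cast
        ring
      rw [Function.iterate_succ_apply', ih, map_sum]
      simp only [hterm, hBs, add_mul, Finset.sum_add_distrib]
      congr 1
      · rw [Finset.sum_range_succ _ (i + 1), hlt i (i + 1) (by lia)]
        simp
      · rw [Finset.sum_range_succ' _ (i + 1)]
        simp

/-- The Wronskian of `h, h * x, …, h * x ^ t`. -/
theorem Derivation.det_iterate_mul_pow {k R : Type*} [CommRing k] [CommRing R] [Algebra k R]
    (d : Derivation k R R)
    (h x : R) (t : ℕ) :
    Matrix.det (Matrix.of fun i j : Fin (t + 1) => d^[(i : ℕ)] (h * x ^ (j : ℕ))) =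
      (∏ u : Fin (t + 1), ((u : ℕ).factorial : R)) *
        (h ^ (t + 1) * d x ^ (t * (t + 1) / 2)) := by
  obtain ⟨B, hlt, hdiag, hB⟩ := d.exists_iterate_mul_pow h x
  have hmul : (Matrix.of fun i j : Fin (t + 1) => d^[(i : ℕ)] (h * x ^ (j : ℕ))) =
      (Matrix.of fun i k : Fin (t + 1) => B i k) *
        (Matrix.of fun k j : Fin (t + 1) =>
          (((j : ℕ).descFactorial k : R) * x ^ ((j : ℕ) - (k : ℕ)))) := by
    ext i j
    rw [Matrix.mul_apply]
    simp only [Matrix.of_apply]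
    rw [hB, Fin.sum_univ_eq_sum_range
      (fun k => B i k * (((j : ℕ).descFactorial k : R) * x ^ ((j : ℕ) - k)))]
    refine Finset.sum_subset (by simpa using i.2) fun k _ hk => ?_
    rw [hlt i k (by simpa using hk), zero_mul]
  have hL : (Matrix.of fun i k : Fin (t + 1) => B i k).IsLowerTriangular :=
    fun i k hik => hlt i k hik
  have hU : (Matrix.of fun k j : Fin (t + 1) =>
      (((j : ℕ).descFactorial k : R) * x ^ ((j : ℕ) - (k : ℕ)))).IsUpperTriangular :=
    fun k j hjk => by simp [Nat.descFactorial_of_lt (show (j : ℕ) < k from hjk)]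
  rw [hmul, Matrix.det_mul, Matrix.det_of_isLowerTriangular _ hL, Matrix.det_of_isUpperTriangular hU]
  simp only [Matrix.of_apply, hdiag, Nat.descFactorial_self, Nat.sub_self, pow_zero, mul_one,
    Finset.prod_mul_distrib, Finset.prod_const, Finset.card_univ, Fintype.card_fin]
  rw [Fin.prod_univ_eq_prod_range (fun i => d x ^ i), Finset.prod_pow_eq_pow_sum,
    Finset.sum_range_id, Nat.add_sub_cancel, Nat.mul_comm (t + 1) t]
  ring

/-- The Wronskian of the monomials of degree `t` in `f` and a unit `g`. -/
theorem Derivation.det_iterate_pow_mul_pow {k R : Type*} [CommRing k] [CommRing R] [Algebra k R]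
    (d : Derivation k R R)
    (f g : R) (hg : IsUnit g) (t : ℕ) :
    Matrix.det (Matrix.of fun i j : Fin (t + 1) =>
        d^[(i : ℕ)] (f ^ (j : ℕ) * g ^ (t - (j : ℕ)))) =
      (∏ u : Fin (t + 1), ((u : ℕ).factorial : R)) *
        (d f * g - f * d g) ^ (t * (t + 1) / 2) := by
  obtain ⟨v, hv⟩ := hg.exists_right_inv
  -- Reduction to `h = g ^ t` and `x = f / g`.
  have hcol (j : Fin (t + 1)) :
      f ^ (j : ℕ) * g ^ (t - (j : ℕ)) = g ^ t * (f * v) ^ (j : ℕ) := by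
    have hj : g ^ t = g ^ (j : ℕ) * g ^ (t - (j : ℕ)) := by
      rw [← pow_add, Nat.add_sub_cancel' (Nat.lt_succ_iff.mp j.2)]
    rw [hj, mul_pow]
    have : g ^ (j : ℕ) * v ^ (j : ℕ) = 1 := by rw [← mul_pow, hv, one_pow]
    linear_combination (-(f ^ (j : ℕ) * g ^ (t - (j : ℕ)))) * this
  simp only [hcol]
  rw [d.det_iterate_mul_pow]
  congr 1
  have hdv : d v * g = -(v * d g) := by
    have := congrArg d hv
    rw [d.leibniz, d.map_one_eq_zero] at this
    simp only [smul_eq_mul] at this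
    linear_combination this
  have hquot : g ^ 2 * d (f * v) = d f * g - f * d g := by
    rw [d.leibniz]
    simp only [smul_eq_mul]
    linear_combination f * g * hdv + (d f * g - f * d g) * hv
  -- Since `t (t + 1)` is even, `(g ^ t) ^ (t + 1)` is exactly the power of `g ^ 2` that clears the
  -- denominators of `d x`.
  rw [← hquot, mul_pow, ← pow_mul, ← pow_mul,
    Nat.mul_div_cancel' (Nat.even_mul_succ_self t).two_dvd]

/-! ### Bounded periodic functions and their `q`-expansions. -/

open Function Derivative in
theorem comp_ofComplex_eq_cuspFunction {f : ℍ → ℂ} (hper : Periodic (f ∘ ofComplex) 1)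
    (w : ℂ) :
    (f ∘ ofComplex) w = cuspFunction 1 f (Periodic.qParam 1 w) := by
  have hper' : Periodic (f ∘ ofComplex) ((1 : ℝ) : ℂ) := by simpa using hper
  exact (Periodic.eq_cuspFunction one_ne_zero hper' w).symm

open Function Derivative in
/-- The operator `q d/dq` on functions corresponds to `q d/dq` on the unit disc. -/
theorem normalizedDerivOfComplex_eq_qParam_mul_deriv_cuspFunction {f : ℍ → ℂ}
    (hper : Periodic (f ∘ ofComplex) 1) (hhol : MDiff f) (hbdd : IsBoundedAtImInfty f) (z : ℍ) :
    normalizedDerivOfComplex f z =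
      Periodic.qParam 1 z * deriv (cuspFunction 1 f) (Periodic.qParam 1 z) := by
  have hq : HasDerivAt (Periodic.qParam 1)
      (2 * Real.pi * Complex.I * Periodic.qParam 1 z) (z : ℂ) := by
    have h1 := (((hasDerivAt_id (z : ℂ)).const_mul (2 * Real.pi * Complex.I)).div_const
      ((1 : ℝ) : ℂ)).cexp
    convert! h1 using 1
    simp [Periodic.qParam]
    ring
  have hF := (differentiableAt_cuspFunction (h := 1) one_pos (by simpa using hper) hhol hbdd
    (Periodic.norm_qParam_lt_one one_pos z.im_pos)).hasDerivAt
  have hc := hF.comp (z : ℂ) hq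
  have heq : f ∘ ofComplex = cuspFunction 1 f ∘ Periodic.qParam 1 :=
    funext (comp_ofComplex_eq_cuspFunction hper)
  rw [normalizedDerivOfComplex, heq, hc.deriv]
  have : (2 * Real.pi * Complex.I) ≠ 0 := Complex.two_pi_I_ne_zero
  field_simp

/-- The holomorphic functions on the upper half-plane of period `1` that are bounded at `i∞`. -/
noncomputable def boundedPeriodicSubring : Subring (ℍ → ℂ) where
  carrier := {f | Function.Periodic (f ∘ ofComplex) 1 ∧ MDiff f ∧ IsBoundedAtImInfty f}
  mul_mem' := fun ha hb => ⟨ha.1.mul hb.1, ha.2.1.mul hb.2.1, ha.2.2.mul hb.2.2⟩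
  one_mem' := ⟨fun _ => rfl, mdifferentiable_const, Filter.const_boundedAtFilter _ _⟩
  add_mem' := fun ha hb => ⟨ha.1.add hb.1, ha.2.1.add hb.2.1, ha.2.2.add hb.2.2⟩
  zero_mem' := ⟨fun _ => rfl, mdifferentiable_const, Filter.const_boundedAtFilter _ _⟩
  neg_mem' := fun ha => ⟨fun w => congrArg Neg.neg (ha.1 w), ha.2.1.neg, ha.2.2.neg⟩

theorem analyticAt_cuspFunction_of_mem {f : ℍ → ℂ} (hf : f ∈ boundedPeriodicSubring) :
    AnalyticAt ℂ (cuspFunction 1 f) 0 :=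
  analyticAt_cuspFunction_zero one_pos (by simpa using hf.1) hf.2.1 hf.2.2

/-- The derivative is `q F'(q)` with `F'` continuous at `0`, and `q → 0` at `i∞`. -/
theorem normalizedDerivOfComplex_isZeroAtImInfty {f : ℍ → ℂ} (hf : f ∈ boundedPeriodicSubring) :
    IsZeroAtImInfty (Derivative.normalizedDerivOfComplex f) := by
  have h : (Derivative.normalizedDerivOfComplex f) = fun z : ℍ =>
      Function.Periodic.qParam 1 z * deriv (cuspFunction 1 f) (Function.Periodic.qParam 1 z) :=
    funext (normalizedDerivOfComplex_eq_qParam_mul_deriv_cuspFunction hf.1 hf.2.1 hf.2.2)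
  rw [IsZeroAtImInfty, Filter.ZeroAtFilter, h]
  have hq := qParam_tendsto_atImInfty one_pos
  have hd := (analyticAt_cuspFunction_of_mem hf).deriv.continuousAt.tendsto.comp hq
  simpa using hq.mul hd

theorem normalizedDerivOfComplex_mem {f : ℍ → ℂ} (hf : f ∈ boundedPeriodicSubring) :
    Derivative.normalizedDerivOfComplex f ∈ boundedPeriodicSubring := by
  refine ⟨fun w => ?_, Derivative.normalizedDerivOfComplex_mdifferentiable hf.2.1,
    (normalizedDerivOfComplex_isZeroAtImInfty hf).isBoundedAtImInfty⟩
  rcases lt_or_ge 0 w.im with hw | hw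
  · have hw' : 0 < (w + 1).im := by simpa using hw
    simp only [Function.comp_apply, ofComplex_apply_of_im_pos hw, ofComplex_apply_of_im_pos hw',
      normalizedDerivOfComplex_eq_qParam_mul_deriv_cuspFunction hf.1 hf.2.1 hf.2.2]
    have : Function.Periodic.qParam 1 (w + 1) = Function.Periodic.qParam 1 w := by
      simpa [Function.Periodic.qParam, mul_add] using
        Complex.exp_periodic (2 * Real.pi * Complex.I * w)
    simp [this]
  -- Off the upper half-plane `ofComplex` is constant, so periodicity is trivial there.
  · simp only [Function.comp_apply]
    rw [ofComplex_apply_eq_of_im_nonpos (by simpa using hw : (w + 1).im ≤ 0) hw]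

theorem qExpansion_normalizedDerivOfComplex {f : ℍ → ℂ} (hf : f ∈ boundedPeriodicSubring) :
    qExpansion 1 (Derivative.normalizedDerivOfComplex f) =
      qEulerDerivation (qExpansion 1 f) := by
  have han := analyticAt_cuspFunction_of_mem hf
  have heq : cuspFunction 1 (Derivative.normalizedDerivOfComplex f) =ᶠ[nhds 0]
      fun q => q * deriv (cuspFunction 1 f) q := by
    filter_upwards [Metric.ball_mem_nhds (0 : ℂ) one_pos] with q hq
    have hq1 : ‖q‖ < 1 := by simpa using hq
    rcases eq_or_ne q 0 with rfl | hq0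
    · rw [zero_mul]
      exact (normalizedDerivOfComplex_isZeroAtImInfty hf).cuspFunction_apply_zero one_pos
    · have him := Function.Periodic.im_invQParam_pos_of_norm_lt_one one_pos hq1 hq0
      have hinv := Function.Periodic.qParam_right_inv (one_ne_zero (α := ℝ)) hq0
      have h1 := comp_ofComplex_eq_cuspFunction (normalizedDerivOfComplex_mem hf).1
        (Function.Periodic.invQParam 1 q)
      rw [hinv, Function.comp_apply, ofComplex_apply_of_im_pos him,
        normalizedDerivOfComplex_eq_qParam_mul_deriv_cuspFunction hf.1 hf.2.1 hf.2.2] at h1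
      rw [← h1]
      simp only [hinv]
  ext n
  rw [coeff_qEulerDerivation, qExpansion_coeff, qExpansion_coeff, heq.iteratedDeriv_eq,
    iteratedDeriv_fun_mul contDiffAt_fun_id han.deriv.contDiffAt]
  simp only [iteratedDeriv_fun_id_zero]
  rcases n with _ | n
  · simp
  -- In the Leibniz formula for `q * F'` at `0`, only the term differentiating `q` exactly once
  -- survives.
  · rw [Finset.sum_eq_single 1 (by intro i _ hi; simp [hi]) (by simp)]
    rw [Nat.add_sub_cancel, ← iteratedDeriv_succ']
    simp
    ring

theorem qExpansion_injective {f g : ℍ → ℂ} (hf : f ∈ boundedPeriodicSubring)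
    (hg : g ∈ boundedPeriodicSubring) (h : qExpansion 1 f = qExpansion 1 g) : f = g := by
  have hfg := sub_mem hf hg
  rw [← sub_eq_zero, ← qExpansion_eq_zero_iff one_pos (by simpa using hfg.1) hfg.2.1 hfg.2.2,
    qExpansion_sub (analyticAt_cuspFunction_of_mem hf) (analyticAt_cuspFunction_of_mem hg), h,
    sub_self]

/-- The `q`-expansion as a ring homomorphism. -/
noncomputable def boundedPeriodicQExpansion : boundedPeriodicSubring →+* PowerSeries ℂ where
  toFun f := qExpansion 1 (f : ℍ → ℂ)
  map_one' := qExpansion_one 1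
  map_mul' f g := qExpansion_mul (analyticAt_cuspFunction_of_mem f.2)
    (analyticAt_cuspFunction_of_mem g.2)
  map_zero' := qExpansion_zero 1
  map_add' f g := qExpansion_add (analyticAt_cuspFunction_of_mem f.2)
    (analyticAt_cuspFunction_of_mem g.2)

theorem normalizedDerivOfComplex_iterate_mem {f : ℍ → ℂ} (hf : f ∈ boundedPeriodicSubring)
    (n : ℕ) : Derivative.normalizedDerivOfComplex^[n] f ∈ boundedPeriodicSubring := by
  induction n with
  | zero => exact hf
  | succ n ih =>
    rw [Function.iterate_succ_apply']
    exact normalizedDerivOfComplex_mem ih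

theorem qExpansion_normalizedDerivOfComplex_iterate {f : ℍ → ℂ}
    (hf : f ∈ boundedPeriodicSubring) (n : ℕ) :
    qExpansion 1 (Derivative.normalizedDerivOfComplex^[n] f) =
      qEulerDerivation^[n] (qExpansion 1 f) := by
  induction n with
  | zero => rfl
  | succ n ih =>
    rw [Function.iterate_succ_apply', Function.iterate_succ_apply',
      qExpansion_normalizedDerivOfComplex (normalizedDerivOfComplex_iterate_mem hf n), ih]

/-- The `q`-Wronskian of functions is holomorphic, `1`-periodic and bounded at `i∞`, and its
`q`-expansion is the `q`-Wronskian of the `q`-expansions. -/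
theorem qWronskian_mem_and_qExpansion {k : ℕ} {f : Fin k → ℍ → ℂ}
    (hf : ∀ j, f j ∈ boundedPeriodicSubring) :
    qWronskian f ∈ boundedPeriodicSubring ∧ qExpansion 1 (qWronskian f) = qWronskianSeries f := by
  -- Evaluation at a point and `q`-expansion are both ring homomorphisms on the subring, so both
  -- commute with this determinant.
  let M : Matrix (Fin k) (Fin k) boundedPeriodicSubring := Matrix.of fun i j =>
    ⟨_, normalizedDerivOfComplex_iterate_mem (hf j) i⟩
  have hM : qWronskian f = (M.det : ℍ → ℂ) := by
    ext z
    have := ((Pi.evalRingHom (fun _ : ℍ => ℂ) z).comp boundedPeriodicSubring.subtype).map_det M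
    exact this.symm
  refine ⟨hM ▸ M.det.2, ?_⟩
  rw [hM]
  refine (boundedPeriodicQExpansion.map_det M).trans (congrArg Matrix.det ?_)
  ext1 i j
  exact qExpansion_normalizedDerivOfComplex_iterate (hf j) i

theorem modularForm_mem_boundedPeriodicSubring {F : Type*} [FunLike F ℍ ℂ] {k : ℤ}
    [ModularFormClass F 𝒮ℒ k] (f : F) : (f : ℍ → ℂ) ∈ boundedPeriodicSubring :=
  ⟨by simpa using SlashInvariantFormClass.periodic_comp_ofComplex f one_mem_strictPeriods_SL,
    ModularFormClass.holo f, ModularFormClass.bdd_at_infty f⟩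

/-! ### The bracket of `E₄` and `E₆` is `1728 Δ`. -/

/-- The bracket `3 (q dE₄/dq) E₆ - 2 E₄ (q dE₆/dq)`. -/
noncomputable def eisensteinBracket : ℍ → ℂ :=
  (3 : ℂ) • (Derivative.normalizedDerivOfComplex ModularForm.E₄ * ModularForm.E₆) -
    (2 : ℂ) • (ModularForm.E₄ * Derivative.normalizedDerivOfComplex ModularForm.E₆ : ℍ → ℂ)

/-- The `E₂` corrections cancel because `3 * 4 = 2 * 6`; modularity of the bracket follows from that
of Serre derivatives. -/
theorem eisensteinBracket_eq_serreDerivative :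
    eisensteinBracket =
      (3 : ℂ) • (Derivative.serreDerivative ((4 : ℤ) : ℂ) ModularForm.E₄ * ModularForm.E₆) -
        (2 : ℂ) •
          (ModularForm.E₄ * Derivative.serreDerivative ((6 : ℤ) : ℂ) ModularForm.E₆ : ℍ → ℂ) := by
  ext z
  simp [eisensteinBracket]
  ring

theorem eisensteinBracket_slash (γ : SL(2, ℤ)) :
    eisensteinBracket ∣[(12 : ℤ)] γ = eisensteinBracket := by
  have h4 : (ModularForm.E₄ : ℍ → ℂ) ∣[(4 : ℤ)] γ = ModularForm.E₄ :=
    ModularForm.E₄.slash_action_eq' _ ⟨γ, rfl⟩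
  have h6 : (ModularForm.E₆ : ℍ → ℂ) ∣[(6 : ℤ)] γ = ModularForm.E₆ :=
    ModularForm.E₆.slash_action_eq' _ ⟨γ, rfl⟩
  have h4' := Derivative.serreDerivative_slash_invariant
    (ModularFormClass.holo ModularForm.E₄) h4
  have h6' := Derivative.serreDerivative_slash_invariant
    (ModularFormClass.holo ModularForm.E₆) h6
  have e1 := ModularForm.mul_slash_SL2 (4 + 2) 6 γ
    (Derivative.serreDerivative ((4 : ℤ) : ℂ) ModularForm.E₄) ModularForm.E₆
  have e2 := ModularForm.mul_slash_SL2 4 (6 + 2) γ ModularForm.E₄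
    (Derivative.serreDerivative ((6 : ℤ) : ℂ) ModularForm.E₆)
  rw [h4', h6] at e1
  rw [h4, h6'] at e2
  rw [eisensteinBracket_eq_serreDerivative, sub_eq_add_neg, SlashAction.add_slash,
    SlashAction.neg_slash, ModularForm.SL_smul_slash, ModularForm.SL_smul_slash]
  exact congrArg₂ (fun a b => (3 : ℂ) • a + -((2 : ℂ) • b)) e1 e2

theorem eisensteinBracket_isZeroAtImInfty : IsZeroAtImInfty eisensteinBracket := by
  have h4 := modularForm_mem_boundedPeriodicSubring ModularForm.E₄
  have h6 := modularForm_mem_boundedPeriodicSubring ModularForm.E₆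
  have d4 := (Asymptotics.isLittleO_one_iff ℝ).mpr (normalizedDerivOfComplex_isZeroAtImInfty h4)
  have d6 := (Asymptotics.isLittleO_one_iff ℝ).mpr (normalizedDerivOfComplex_isZeroAtImInfty h6)
  have a := d4.mul_isBigO h6.2.2
  have b := h4.2.2.mul_isLittleO d6
  refine (Asymptotics.isLittleO_one_iff ℝ).mp ?_
  simpa using! (a.const_mul_left 3).sub (b.const_mul_left 2)

/-- The bracket as a cusp form of weight `12`. -/
noncomputable def eisensteinBracketCuspForm : CuspForm 𝒮ℒ 12 where
  toFun := eisensteinBracket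
  slash_action_eq' A hA := by
    obtain ⟨A, rfl⟩ := hA
    exact eisensteinBracket_slash A
  holo' := by
    have h4 := ModularFormClass.holo ModularForm.E₄
    have h6 := ModularFormClass.holo ModularForm.E₆
    exact (((Derivative.normalizedDerivOfComplex_mdifferentiable h4).mul h6).const_smul
      (3 : ℂ)).sub ((h4.mul (Derivative.normalizedDerivOfComplex_mdifferentiable h6)).const_smul
        (2 : ℂ))
  zero_at_cusps' hc := by
    rw [Subgroup.IsArithmetic.isCusp_iff_isCusp_SL2Z] at hc
    rw [OnePoint.isZeroAt_iff_forall_SL2Z hc]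
    intro γ _
    rw [eisensteinBracket_slash]
    exact eisensteinBracket_isZeroAtImInfty

theorem qExpansion_eisensteinBracket :
    qExpansion 1 eisensteinBracket =
      (3 : ℂ) • (qEulerDerivation (qExpansion 1 ModularForm.E₄) * qExpansion 1 ModularForm.E₆) -
        (2 : ℂ) •
          (qExpansion 1 ModularForm.E₄ * qEulerDerivation (qExpansion 1 ModularForm.E₆)) := by
  have h4 := modularForm_mem_boundedPeriodicSubring ModularForm.E₄
  have h6 := modularForm_mem_boundedPeriodicSubring ModularForm.E₆
  have a4 := analyticAt_cuspFunction_of_mem h4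
  have a6 := analyticAt_cuspFunction_of_mem h6
  have d4 := analyticAt_cuspFunction_of_mem (normalizedDerivOfComplex_mem h4)
  have d6 := analyticAt_cuspFunction_of_mem (normalizedDerivOfComplex_mem h6)
  have m1 := mul_mem (normalizedDerivOfComplex_mem h4) h6
  have m2 := mul_mem h4 (normalizedDerivOfComplex_mem h6)
  have s1 : AnalyticAt ℂ (cuspFunction 1 ((3 : ℂ) •
      (Derivative.normalizedDerivOfComplex ModularForm.E₄ * ModularForm.E₆))) 0 := by
    rw [cuspFunction_smul (analyticAt_cuspFunction_of_mem m1).continuousAt]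
    exact (analyticAt_cuspFunction_of_mem m1).const_smul
  have s2 : AnalyticAt ℂ (cuspFunction 1 ((2 : ℂ) •
      (ModularForm.E₄ * Derivative.normalizedDerivOfComplex ModularForm.E₆ : ℍ → ℂ))) 0 := by
    rw [cuspFunction_smul (analyticAt_cuspFunction_of_mem m2).continuousAt]
    exact (analyticAt_cuspFunction_of_mem m2).const_smul
  rw [eisensteinBracket, qExpansion_sub s1 s2, qExpansion_smul (analyticAt_cuspFunction_of_mem m1),
    qExpansion_smul (analyticAt_cuspFunction_of_mem m2), qExpansion_mul d4 a6,
    qExpansion_mul a4 d6, qExpansion_normalizedDerivOfComplex h4,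
    qExpansion_normalizedDerivOfComplex h6]

theorem eisensteinBracket_eq_smul_discriminant :
    eisensteinBracket = (1728 : ℂ) • ModularForm.discriminant := by
  obtain ⟨c, hc⟩ :=
    CuspForm.exists_smul_discriminant_of_weight_eq_twelve eisensteinBracketCuspForm
  have hfun : c • ModularForm.discriminant = eisensteinBracket := congrArg DFunLike.coe hc
  have hq : c • qExpansion 1 ModularForm.discriminant = qExpansion 1 eisensteinBracket := by
    rw [← hfun]
    exact (ModularForm.qExpansion_smul one_pos one_mem_strictPeriods_SL c
      CuspForm.discriminant).symm
  rw [qExpansion_eisensteinBracket] at hq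
  -- The coefficient of `q` fixes the constant: `3 * 240 + 2 * 504 = 1728`.
  have h1 := congrArg (PowerSeries.coeff 1) hq
  norm_num [PowerSeries.coeff_mul, Finset.Nat.antidiagonal_succ, coeff_qEulerDerivation,
    ModularForm.discriminant_qExpansion_coeff_one, ModularForm.E₄_qExpansion_coeff_one,
    ModularForm.E₆_qExpansion_coeff_one, EisensteinSeries.E_qExpansion_coeff_zero _ ⟨2, rfl⟩,
    EisensteinSeries.E_qExpansion_coeff_zero _ ⟨3, rfl⟩, -PowerSeries.coeff_zero_eq_constantCoeff]
    at h1
  rw [← hfun, h1]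

/-! ### The Wronskian of the Eisenstein monomials. -/

/-- The operator `q d/dq` on formal power series as a derivation. -/
noncomputable def qEulerDerivationHom : Derivation ℂ (PowerSeries ℂ) (PowerSeries ℂ) :=
  (PowerSeries.X : PowerSeries ℂ) • PowerSeries.derivative ℂ

theorem coe_qEulerDerivationHom : ⇑qEulerDerivationHom = qEulerDerivation := rfl

theorem qEulerDerivation_bracket :
    (3 : ℂ) • (qEulerDerivation (qExpansion 1 ModularForm.E₄) * qExpansion 1 ModularForm.E₆) -
        (2 : ℂ) •
          (qExpansion 1 ModularForm.E₄ * qEulerDerivation (qExpansion 1 ModularForm.E₆)) =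
      (1728 : ℂ) • qExpansion 1 ModularForm.discriminant := by
  rw [← qExpansion_eisensteinBracket, eisensteinBracket_eq_smul_discriminant]
  exact ModularForm.qExpansion_smul one_pos one_mem_strictPeriods_SL 1728 CuspForm.discriminant

theorem qExpansion_eisensteinMonomial (t : ℕ) (u : Fin (t + 1)) :
    qExpansion 1 (eisensteinMonomial t u) =
      (qExpansion 1 ModularForm.E₄ ^ 3) ^ (u : ℕ) *
        (qExpansion 1 ModularForm.E₆ ^ 2) ^ (t - (u : ℕ)) := by
  have h4 := modularForm_mem_boundedPeriodicSubring ModularForm.E₄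
  have h6 := modularForm_mem_boundedPeriodicSubring ModularForm.E₆
  rw [coe_eisensteinMonomial]
  have := boundedPeriodicQExpansion.map_mul ((⟨_, h4⟩ ^ 3) ^ (u : ℕ))
    ((⟨_, h6⟩ ^ 2) ^ (t - (u : ℕ)))
  simp only [map_pow] at this
  exact this

/-- The constant of proportionality of the `q`-Wronskian of the Eisenstein monomials. -/
noncomputable def eisensteinWronskianConst (t : ℕ) : ℂ :=
  (∏ u : Fin (t + 1), ((u : ℕ).factorial : ℂ)) * 1728 ^ (t * (t + 1) / 2)

theorem eisensteinWronskianConst_ne_zero (t : ℕ) : eisensteinWronskianConst t ≠ 0 :=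
  mul_ne_zero (Finset.prod_ne_zero_iff.mpr fun u _ => by exact_mod_cast (u : ℕ).factorial_ne_zero)
    (pow_ne_zero _ (by norm_num))

theorem qWronskianSeries_eisensteinMonomial (t : ℕ) :
    qWronskianSeries (fun u : Fin (t + 1) => (eisensteinMonomial t u : ℍ → ℂ)) =
      eisensteinWronskianConst t • (qExpansion 1 ModularForm.discriminant ^ (t * (t + 1) / 2) *
        qExpansion 1 ModularForm.E₄ ^ (t * (t + 1)) *
        qExpansion 1 ModularForm.E₆ ^ (t * (t + 1) / 2)) := by
  -- The constant term of `E₆` is `1`.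
  have hunit : IsUnit (qExpansion 1 ModularForm.E₆ ^ 2) := by
    refine IsUnit.pow 2 (PowerSeries.isUnit_iff_constantCoeff.mpr ?_)
    rw [← PowerSeries.coeff_zero_eq_constantCoeff_apply,
      EisensteinSeries.E_qExpansion_coeff_zero _ ⟨3, rfl⟩]
    exact isUnit_one
  have hdet := qEulerDerivationHom.det_iterate_pow_mul_pow (qExpansion 1 ModularForm.E₄ ^ 3)
    (qExpansion 1 ModularForm.E₆ ^ 2) hunit t
  have hbr : qEulerDerivationHom (qExpansion 1 ModularForm.E₄ ^ 3) *
      qExpansion 1 ModularForm.E₆ ^ 2 -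
        qExpansion 1 ModularForm.E₄ ^ 3 * qEulerDerivationHom (qExpansion 1 ModularForm.E₆ ^ 2) =
      (1728 : ℂ) • (qExpansion 1 ModularForm.discriminant * qExpansion 1 ModularForm.E₄ ^ 2 *
        qExpansion 1 ModularForm.E₆) := by
    have h := qEulerDerivation_bracket
    simp only [PowerSeries.smul_eq_C_mul, map_ofNat] at h ⊢
    rw [Derivation.leibniz_pow, Derivation.leibniz_pow, coe_qEulerDerivationHom]
    simp only [nsmul_eq_mul, smul_eq_mul]
    push_cast
    linear_combination (qExpansion 1 ModularForm.E₄ ^ 2 * qExpansion 1 ModularForm.E₆) * h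
  rw [hbr] at hdet
  have h2 : 2 * (t * (t + 1) / 2) = t * (t + 1) :=
    Nat.mul_div_cancel' (Nat.even_mul_succ_self t).two_dvd
  simp only [qWronskianSeries, qExpansion_eisensteinMonomial]
  rw [coe_qEulerDerivationHom] at hdet
  rw [hdet, ← h2, pow_mul (qExpansion 1 ModularForm.E₄), eisensteinWronskianConst]
  simp only [PowerSeries.smul_eq_C_mul, map_mul, map_prod, map_natCast, map_pow, mul_pow, h2]
  ring

theorem qWronskian_eisensteinMonomial (t : ℕ) (z : ℍ) :
    qWronskian (fun u : Fin (t + 1) => (eisensteinMonomial t u : ℍ → ℂ)) z =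
      eisensteinWronskianConst t * (ModularForm.discriminant z ^ (t * (t + 1) / 2) *
        ModularForm.E₄ z ^ (t * (t + 1)) * ModularForm.E₆ z ^ (t * (t + 1) / 2)) := by
  obtain ⟨hmem, hq⟩ := qWronskian_mem_and_qExpansion
    (fun u : Fin (t + 1) => modularForm_mem_boundedPeriodicSubring (eisensteinMonomial t u))
  have h4 := modularForm_mem_boundedPeriodicSubring ModularForm.E₄
  have h6 := modularForm_mem_boundedPeriodicSubring ModularForm.E₆
  have hΔ : ModularForm.discriminant ∈ boundedPeriodicSubring :=
    modularForm_mem_boundedPeriodicSubring CuspForm.discriminant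
  have hc : (fun _ => eisensteinWronskianConst t : ℍ → ℂ) ∈ boundedPeriodicSubring :=
    ⟨fun _ => rfl, mdifferentiable_const, Filter.const_boundedAtFilter _ _⟩
  let F : boundedPeriodicSubring := ⟨_, hΔ⟩ ^ (t * (t + 1) / 2) *
    ⟨_, h4⟩ ^ (t * (t + 1)) * ⟨_, h6⟩ ^ (t * (t + 1) / 2)
  have hF : boundedPeriodicQExpansion F =
      qExpansion 1 ModularForm.discriminant ^ (t * (t + 1) / 2) *
        qExpansion 1 ModularForm.E₄ ^ (t * (t + 1)) *
        qExpansion 1 ModularForm.E₆ ^ (t * (t + 1) / 2) := by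
    simp only [F, map_mul, map_pow]
    rfl
  have hcF : eisensteinWronskianConst t • (F : ℍ → ℂ) ∈ boundedPeriodicSubring :=
    mul_mem hc F.2
  have heq := qExpansion_injective hmem hcF (by
    rw [hq, qWronskianSeries_eisensteinMonomial, ← hF,
      qExpansion_smul (analyticAt_cuspFunction_of_mem F.2)]
    rfl)
  exact congrFun heq z

/-! ### The basis property. -/

theorem qEulerDerivation_iterate_sum_smul {ι : Type*} (s : Finset ι) (c : ι → ℂ)
    (f : ι → PowerSeries ℂ) (n : ℕ) :
    qEulerDerivation^[n] (∑ j ∈ s, c j • f j) = ∑ j ∈ s, c j • qEulerDerivation^[n] (f j) := by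
  have hcoeff (g : PowerSeries ℂ) (m : ℕ) :
      (qEulerDerivation^[n] g).coeff m = (m : ℂ) ^ n * g.coeff m := by
    induction n with
    | zero => simp
    | succ n ih =>
      rw [Function.iterate_succ_apply', coeff_qEulerDerivation, ih]
      ring
  ext m
  simp only [hcoeff, map_sum, PowerSeries.coeff_smul, Finset.mul_sum]
  exact Finset.sum_congr rfl fun j _ => by simp; ring

/-- Modular forms with non-zero `q`-Wronskian are linearly independent. -/
theorem linearIndependent_of_qWronskianSeries_ne_zero {n : ℕ} {k : ℤ}
    {f : Fin n → ModularForm 𝒮ℒ k} (h : qWronskianSeries (fun j => (f j : ℍ → ℂ)) ≠ 0) :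
    LinearIndependent ℂ f := by
  let L : ModularForm 𝒮ℒ k →ₗ[ℂ] PowerSeries ℂ :=
    { toFun := fun g => qExpansion 1 g
      map_add' := fun a b => ModularForm.qExpansion_add one_pos one_mem_strictPeriods_SL a b
      map_smul' := fun c a => ModularForm.qExpansion_smul one_pos one_mem_strictPeriods_SL c a }
  rw [Fintype.linearIndependent_iff]
  intro c hc
  have hL : ∑ j, c j • qExpansion 1 (f j) = 0 := by
    have := congrArg L hc
    simpa only [map_sum, map_smul, map_zero] using! this
  -- A linear relation with constant coefficients survives every `(q d/dq)^i`, so it lies in the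
  -- kernel of the Wronskian matrix.
  have hv := Matrix.eq_zero_of_mulVec_eq_zero (v := fun j => PowerSeries.C (c j)) h (by
    ext1 i
    have := qEulerDerivation_iterate_sum_smul Finset.univ c (fun j => qExpansion 1 (f j)) i
    rw [hL, ← coe_qEulerDerivationHom, iterate_map_zero, coe_qEulerDerivationHom] at this
    simp only [Matrix.mulVec, dotProduct, Matrix.of_apply, Pi.zero_apply]
    rw [this]
    exact Finset.sum_congr rfl fun j _ => by rw [PowerSeries.smul_eq_C_mul, mul_comm])
  intro j
  simpa using congrFun hv j

theorem linearIndependent_eisensteinMonomial (t : ℕ) :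
    LinearIndependent ℂ (eisensteinMonomial t) := by
  apply linearIndependent_of_qWronskianSeries_ne_zero
  rw [qWronskianSeries_eisensteinMonomial]
  have hne {p : PowerSeries ℂ} {n : ℕ} (h : p.coeff n = 1) : p ≠ 0 := by
    rintro rfl
    simp at h
  have hΔ := hne ModularForm.discriminant_qExpansion_coeff_one
  have h4 : qExpansion 1 ModularForm.E₄ ≠ 0 :=
    hne (EisensteinSeries.E_qExpansion_coeff_zero _ ⟨2, rfl⟩)
  have h6 : qExpansion 1 ModularForm.E₆ ≠ 0 :=
    hne (EisensteinSeries.E_qExpansion_coeff_zero _ ⟨3, rfl⟩)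
  exact smul_ne_zero (eisensteinWronskianConst_ne_zero t)
    (mul_ne_zero (mul_ne_zero (pow_ne_zero _ hΔ) (pow_ne_zero _ h4)) (pow_ne_zero _ h6))

theorem finrank_modularForm_twelve_mul (t : ℕ) :
    Module.finrank ℂ (ModularForm 𝒮ℒ (12 * (t : ℤ))) = t + 1 := by
  have h := ModularForm.dimension_level_one (12 * t) ((by decide : Even 12).mul_right t)
  -- The exceptional case of the dimension formula, weight `≡ 2` modulo `12`, does not occur.
  rw [if_neg (by simp [Nat.ModEq]), Nat.mul_div_cancel_left t (by norm_num)] at h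
  push_cast at h
  exact Module.finrank_eq_of_rank_eq (by exact_mod_cast h)

theorem span_range_eisensteinMonomial (t : ℕ) :
    Submodule.span ℂ (Set.range (eisensteinMonomial t)) = ⊤ :=
  (linearIndependent_eisensteinMonomial t).span_eq_top_of_card_eq_finrank' (by
    rw [finrank_modularForm_twelve_mul, Fintype.card_fin])

end

/-- The forms `(E₄ ^ 3) ^ u * (E₆ ^ 2) ^ (t - u)`, `0 ≤ u ≤ t`, are a basis of the space of modular
forms of weight `12 t` for `SL(2, ℤ)`, and their `q`-Wronskian is a non-zero multiple of
`Δ ^ (t (t + 1) / 2) * E₄ ^ (t (t + 1)) * E₆ ^ (t (t + 1) / 2)`, both as `q`-expansions and as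
functions on the upper half-plane, with the same constant. -/
theorem mainTheorem8 (t : ℕ) (ht : 1 ≤ t) :
    (LinearIndependent ℂ (eisensteinMonomial t) ∧
      Submodule.span ℂ (Set.range (eisensteinMonomial t)) = ⊤) ∧
    ∃ c : ℂ, c ≠ 0 ∧
      qWronskianSeries (fun u : Fin (t + 1) => (eisensteinMonomial t u : ℍ → ℂ)) =
        c • (qExpansion 1 ModularForm.discriminant ^ (t * (t + 1) / 2) *
          qExpansion 1 ModularForm.E₄ ^ (t * (t + 1)) *
          qExpansion 1 ModularForm.E₆ ^ (t * (t + 1) / 2)) ∧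
      ∀ z : ℍ, qWronskian (fun u : Fin (t + 1) => (eisensteinMonomial t u : ℍ → ℂ)) z =
        c * (ModularForm.discriminant z ^ (t * (t + 1) / 2) *
          ModularForm.E₄ z ^ (t * (t + 1)) *
          ModularForm.E₆ z ^ (t * (t + 1) / 2)) := by
  exact ⟨⟨linearIndependent_eisensteinMonomial t, span_range_eisensteinMonomial t⟩,
    eisensteinWronskianConst t, eisensteinWronskianConst_ne_zero t,
    qWronskianSeries_eisensteinMonomial t, qWronskian_eisensteinMonomial t⟩
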